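/- Let $\Omega,\Omega'\subset\mathbb C$ be plane domains (nonempty connected open sets), let $\varphi:\Omega\to\Omega'$ be a conformal homeomorphism (a bijection of $\Omega$ onto $\Omega'$ that is holomorphic with $\varphi'\neq 0$ on $\Omega$), and let $1\le q<p<\infty$. For a domain $D\subset\mathbb C$ and $1\le s<\infty$, let $L^1_s(D)$ be the space of locally integrable, weakly differentiable functions $f:D\to\mathbb R$ (with locally integrable weak gradient $\nabla f$) whose seminorm $$\|f\mid L^1_s(D)\|=\Big(\int_D|\nabla f(z)|^s\,d\mu\Big)^{1/s}$$ is finite, where $\mu$ is Lebesgue measure. One says that $\varphi$ induces a bounded composition operator $\varphi^*:L^1_p(\Omega')\to L^1_q(\Omega)$, $\varphi^*(f)=f\circ\varphi$, if $f\circ\varphi\in L^1_q(\Omega)$ for every $f\in L^1_p(\Omega')$ and there is a constant $C<\infty$ such that $\|f\circ\varphi\mid L^1_q(\Omega)\|\le C\,\|f\mid L^1_p(\Omega')\|$ for all $f\in L^1_p(\Omega')$. Then $\varphi$ induces a bounded composition operator $\varphi^*:L^1_p(\Omega')\to L^1_q(\Omega)$ if and only if $$\Big(\int_\Omega|\varphi'(z)|^{\frac{(p-2)q}{p-q}}\,d\mu\Big)^{\frac{p-q}{pq}}<\infty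 .$$ -/

import Mathlib

open MeasureTheory
open scoped ENNReal NNReal ContDiff

/-- A plane domain: a nonempty connected open subset of `ℂ`. -/
def IsPlaneDomain (Ω : Set ℂ) : Prop :=
  IsOpen Ω ∧ IsConnected Ω

/-- A conformal homeomorphism of `Ω` onto `Ω'`: a bijection `Ω → Ω'` which is holomorphic with
nowhere vanishing derivative on `Ω`. (By the inverse function theorem, the inverse map is then
holomorphic as well, so this is the same as a biholomorphic map.)
Values of `φ` outside `Ω` are irrelevant. -/
structure IsConformalHomeomorph (φ : ℂ → ℂ) (Ω Ω' : Set ℂ) : Prop where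
  bijOn : Set.BijOn φ Ω Ω'
  differentiableOn : DifferentiableOn ℂ φ Ω
  deriv_ne_zero : ∀ z ∈ Ω, deriv φ z ≠ 0

/-- `g` is a weak gradient of the real-valued function `f` in `Ω`: both are locally integrable in
`Ω` and the integration by parts formula holds against every real test function in `C₀^∞(Ω)`.
The gradient `(∂f/∂x, ∂f/∂y)` is recorded as the complex number `∂f/∂x + i ∂f/∂y`, whose modulus
is the Euclidean length of the gradient; `fderiv ℝ ψ z 1` and `fderiv ℝ ψ z Complex.I` are
`∂ψ/∂x` and `∂ψ/∂y`. -/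
structure HasWeakGradient (Ω : Set ℂ) (f : ℂ → ℝ) (g : ℂ → ℂ) : Prop where
  locallyIntegrableOn : LocallyIntegrableOn f Ω volume
  locallyIntegrableOn_grad : LocallyIntegrableOn g Ω volume
  integral_dx : ∀ ψ : ℂ → ℝ, ContDiff ℝ ∞ ψ → HasCompactSupport ψ → tsupport ψ ⊆ Ω →
    ∫ z in Ω, f z * fderiv ℝ ψ z 1 = -∫ z in Ω, (g z).re * ψ z
  integral_dy : ∀ ψ : ℂ → ℝ, ContDiff ℝ ∞ ψ → HasCompactSupport ψ → tsupport ψ ⊆ Ω →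
    ∫ z in Ω, f z * fderiv ℝ ψ z Complex.I = -∫ z in Ω, (g z).im * ψ z

/-- Weak gradients are unique up to a null set. -/
theorem HasWeakGradient.ae_eq {Ω : Set ℂ} (hΩ : IsOpen Ω) {f : ℂ → ℝ} {g₁ g₂ : ℂ → ℂ}
    (h₁ : HasWeakGradient Ω f g₁) (h₂ : HasWeakGradient Ω f g₂) :
    g₁ =ᵐ[volume.restrict Ω] g₂ := by
  have key : ∀ L : ℂ →L[ℝ] ℝ,
      (∀ ψ : ℂ → ℝ, ContDiff ℝ ∞ ψ → HasCompactSupport ψ → tsupport ψ ⊆ Ω →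
        ∫ z in Ω, L (g₁ z) * ψ z = ∫ z in Ω, L (g₂ z) * ψ z) →
      ∀ᵐ z ∂(volume : Measure ℂ), z ∈ Ω → L (g₁ z) - L (g₂ z) = 0 := by
    intro L hL
    have l₁ : LocallyIntegrableOn (fun z => L (g₁ z)) Ω volume := fun x hx => by
      obtain ⟨s, hs, hi⟩ := h₁.locallyIntegrableOn_grad x hx
      exact ⟨s, hs, L.integrable_comp hi⟩
    have l₂ : LocallyIntegrableOn (fun z => L (g₂ z)) Ω volume := fun x hx => by
      obtain ⟨s, hs, hi⟩ := h₂.locallyIntegrableOn_grad x hx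
      exact ⟨s, hs, L.integrable_comp hi⟩
    refine hΩ.ae_eq_zero_of_integral_contDiff_smul_eq_zero (l₁.sub l₂) ?_
    intro ψ hψ hc hs
    have hzero : ∀ z, z ∉ Ω → ψ z = 0 := fun z hz =>
      image_eq_zero_of_notMem_tsupport fun h => hz (hs h)
    have hint : ∀ u : ℂ → ℝ, LocallyIntegrableOn u Ω volume →
        IntegrableOn (fun z => u z * ψ z) Ω volume := by
      intro u hu
      have hk : IntegrableOn u (tsupport ψ) volume :=
        hu.integrableOn_compact_subset hs hc
      have hi : IntegrableOn (fun z => u z * ψ z) (tsupport ψ) volume :=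
        hk.mul_continuousOn hψ.continuous.continuousOn hc
      have : Integrable (fun z => u z * ψ z) volume := by
        rw [← integrableOn_iff_integrable_of_support_subset
          (s := tsupport ψ)]
        · exact hi
        · intro z hz
          exact subset_tsupport _ fun h => hz (by simp [h])
      exact this.integrableOn
    have e : ∫ z in Ω, (L (g₁ z) * ψ z - L (g₂ z) * ψ z) = 0 := by
      rw [integral_sub (hint _ l₁) (hint _ l₂), hL ψ hψ hc hs, sub_self]
    rw [← e, ← setIntegral_eq_integral_of_forall_compl_eq_zero (s := Ω)]
    · refine integral_congr_ae (Filter.Eventually.of_forall fun z => ?_)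
      simp only [smul_eq_mul]
      ring
    · intro z hz
      simp [hzero z hz]
  have hr := key Complex.reCLM fun ψ hψ hc hs => by
    have a := h₁.integral_dx ψ hψ hc hs
    have b := h₂.integral_dx ψ hψ hc hs
    exact neg_injective (a.symm.trans b)
  have hi := key Complex.imCLM fun ψ hψ hc hs => by
    have a := h₁.integral_dy ψ hψ hc hs
    have b := h₂.integral_dy ψ hψ hc hs
    exact neg_injective (a.symm.trans b)
  rw [Filter.EventuallyEq, ae_restrict_iff' hΩ.measurableSet]
  filter_upwards [hr, hi] with z h h' hz
  exact Complex.ext (sub_eq_zero.mp (h hz)) (sub_eq_zero.mp (h' hz))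

/-- `f` is weakly differentiable in `Ω`. -/
def WeaklyDifferentiable (Ω : Set ℂ) (f : ℂ → ℝ) : Prop :=
  ∃ g : ℂ → ℂ, HasWeakGradient Ω f g

open Classical in
/-- The weak gradient of `f` in `Ω`, unique up to a null set (and `0` if `f` is not weakly
differentiable in `Ω`). -/
noncomputable def weakGradient (Ω : Set ℂ) (f : ℂ → ℝ) : ℂ → ℂ :=
  if h : WeaklyDifferentiable Ω f then h.choose else 0

/-- The seminorm `(∫_Ω |∇f|^p dμ)^(1/p)` of the homogeneous Sobolev space `L^1_p(Ω)`. -/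
noncomputable def homSobolevSeminorm (p : ℝ) (Ω : Set ℂ) (f : ℂ → ℝ) : ℝ≥0∞ :=
  (∫⁻ z in Ω, ENNReal.ofReal (‖weakGradient Ω f z‖ ^ p)) ^ (1 / p)

/-- `f` belongs to the homogeneous Sobolev space `L^1_p(Ω)`: it is weakly differentiable in `Ω`
and its seminorm is finite. -/
def MemHomSobolev (p : ℝ) (Ω : Set ℂ) (f : ℂ → ℝ) : Prop :=
  WeaklyDifferentiable Ω f ∧ homSobolevSeminorm p Ω f < (⊤ : ℝ≥0∞)

/-- `φ : Ω → Ω'` induces a bounded composition operator `L^1_p(Ω') → L^1_q(Ω)`, `f ↦ f ∘ φ`. -/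
def InducesBoundedComposition (φ : ℂ → ℂ) (Ω Ω' : Set ℂ) (p q : ℝ) : Prop :=
  (∀ f : ℂ → ℝ, MemHomSobolev p Ω' f → MemHomSobolev q Ω (f ∘ φ)) ∧
  ∃ K : ℝ≥0, ∀ f : ℂ → ℝ, MemHomSobolev p Ω' f →
    homSobolevSeminorm q Ω (f ∘ φ) ≤ K * homSobolevSeminorm p Ω' f

/-! Under a conformal map the weak gradient transforms by `conj φ' · (g ∘ φ)`, so its length is
multiplied by `|φ'|`, while the Jacobian is `|φ'|²`. The boundedness question is therefore about the
weight `|φ'|` alone.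

Sufficiency is Hölder's inequality with exponents `p/q` and `p/(p-q)`, after the change of variables
(`lintegral_pullback_grad_le`).

Necessity has to pass from gradients to arbitrary functions. Given a smooth compactly supported `θ`,
the functions `θ(w) ε sin(Re w/ε + c)` have gradients of size about `|θ| |cos|`, and two phases a
quarter period apart together control `|θ|`. As `ε → 0` boundedness yields `‖|φ'| · θ∘φ‖_q ≤ 2K
‖θ‖_p` (`eLpNorm_weighted_le_of_gradient_le`). Inserting a cut-off version of the extremal function
of Hölder's inequality bounds the integral over each compact subset of `Ω`, uniformly
(`setLIntegral_compact_le`), and exhausting `Ω` by compact sets finishes the proof. -/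

/-- The real determinant of complex multiplication by `a` is `‖a‖ ^ 2`. -/
theorem Complex.det_restrictScalars_toSpanSingleton (a : ℂ) :
    ((ContinuousLinearMap.toSpanSingleton ℂ a).restrictScalars ℝ).det = ‖a‖ ^ 2 := by
  rw [ContinuousLinearMap.det, ← LinearMap.det_toMatrix Complex.basisOneI, Matrix.det_fin_two]
  simp only [LinearMap.toMatrix_apply, Complex.coe_basisOneI, Complex.coe_basisOneI_repr]
  simp [Complex.sq_norm, Complex.normSq_apply]

/-! ### Conformal maps: the inverse, change of variables, regularity -/

namespace IsConformalHomeomorph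

variable {φ : ℂ → ℂ} {Ω Ω' : Set ℂ}

theorem hasDerivAt (h : IsConformalHomeomorph φ Ω Ω') (hΩ : IsOpen Ω) {z : ℂ} (hz : z ∈ Ω) :
    HasDerivAt φ (deriv φ z) z :=
  (h.differentiableOn.differentiableAt (hΩ.mem_nhds hz)).hasDerivAt

theorem exists_inverse (h : IsConformalHomeomorph φ Ω Ω') (hΩ : IsOpen Ω) (hΩ' : IsOpen Ω') :
    ∃ η : ℂ → ℂ, IsConformalHomeomorph η Ω' Ω ∧ Set.InvOn η φ Ω Ω' ∧
      ∀ z ∈ Ω, deriv η (φ z) = (deriv φ z)⁻¹ := by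
  set η := Function.invFunOn φ Ω with hη
  have hinv : Set.InvOn η φ Ω Ω' := h.bijOn.invOn_invFunOn
  have hmaps : Set.MapsTo η Ω' Ω := h.bijOn.surjOn.mapsTo_invFunOn
  have hd : ∀ z ∈ Ω, HasDerivAt η (deriv φ z)⁻¹ (φ z) := by
    intro z hz
    have hs : HasStrictDerivAt φ (deriv φ z) z :=
      ((h.differentiableOn.analyticAt (hΩ.mem_nhds hz)).hasStrictDerivAt)
    -- Since `φ' ≠ 0`, `φ` maps the neighbourhood filter of `z` onto that of `φ z`; continuity of
    -- `η` thus reduces to `η ∘ φ = id` near `z`.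
    have hc : ContinuousAt η (φ z) := by
      rw [ContinuousAt, ← hs.map_nhds_eq (h.deriv_ne_zero z hz), Filter.tendsto_map'_iff,
        hinv.1 hz]
      refine Filter.tendsto_id.congr' ?_
      filter_upwards [hΩ.mem_nhds hz] with w hw
      exact (hinv.1 hw).symm
    refine HasDerivAt.of_local_left_inverse (f := φ) hc ?_ (h.deriv_ne_zero z hz) ?_
    · rw [hinv.1 hz]; exact h.hasDerivAt hΩ hz
    · filter_upwards [hΩ'.mem_nhds (h.bijOn.mapsTo hz)] with w hw
      exact hinv.2 hw
  refine ⟨η, ⟨⟨hmaps, hinv.2.injOn, ?_⟩, ?_, ?_⟩, hinv, fun z hz => (hd z hz).deriv⟩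
  · exact fun z hz => ⟨φ z, h.bijOn.mapsTo hz, hinv.1 hz⟩
  · intro w hw
    have := (hd (η w) (hmaps hw)).differentiableAt
    rw [hinv.2 hw] at this
    exact this.differentiableWithinAt
  · intro w hw
    have := (hd (η w) (hmaps hw)).deriv
    rw [hinv.2 hw] at this
    rw [this]
    exact inv_ne_zero (h.deriv_ne_zero _ (hmaps hw))

theorem hasFDerivWithinAt (h : IsConformalHomeomorph φ Ω Ω') (hΩ : IsOpen Ω) {s : Set ℂ}
    (hs : s ⊆ Ω) (z : ℂ) (hz : z ∈ s) :
    HasFDerivWithinAt φ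
      ((ContinuousLinearMap.toSpanSingleton ℂ (deriv φ z)).restrictScalars ℝ) s z :=
  (h.hasDerivAt hΩ (hs hz)).hasFDerivAt.restrictScalars ℝ |>.hasFDerivWithinAt

theorem setIntegral_eq (h : IsConformalHomeomorph φ Ω Ω') (hΩ : IsOpen Ω) (G : ℂ → ℝ) :
    ∫ w in Ω', G w = ∫ z in Ω, ‖deriv φ z‖ ^ 2 * G (φ z) := by
  rw [← h.bijOn.image_eq, integral_image_eq_integral_abs_det_fderiv_smul volume
    hΩ.measurableSet (h.hasFDerivWithinAt hΩ subset_rfl) h.bijOn.injOn]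
  simp [Complex.det_restrictScalars_toSpanSingleton]

theorem setLIntegral_eq (h : IsConformalHomeomorph φ Ω Ω') (hΩ : IsOpen Ω) (G : ℂ → ℝ≥0∞) :
    ∫⁻ w in Ω', G w = ∫⁻ z in Ω, ENNReal.ofReal (‖deriv φ z‖ ^ 2) * G (φ z) := by
  rw [← h.bijOn.image_eq, lintegral_image_eq_lintegral_abs_det_fderiv_mul volume
    hΩ.measurableSet (h.hasFDerivWithinAt hΩ subset_rfl) h.bijOn.injOn]
  simp [Complex.det_restrictScalars_toSpanSingleton]

theorem continuousOn_deriv (h : IsConformalHomeomorph φ Ω Ω') (hΩ : IsOpen Ω) :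
    ContinuousOn (deriv φ) Ω :=
  (h.differentiableOn.deriv hΩ).continuousOn

theorem contDiffOn (h : IsConformalHomeomorph φ Ω Ω') (hΩ : IsOpen Ω) :
    ContDiffOn ℝ ∞ φ Ω :=
  (h.differentiableOn.contDiffOn hΩ).restrict_scalars ℝ

theorem contDiffOn_deriv (h : IsConformalHomeomorph φ Ω Ω') (hΩ : IsOpen Ω) :
    ContDiffOn ℝ ∞ (deriv φ) Ω :=
  ((h.differentiableOn.deriv hΩ).contDiffOn hΩ).restrict_scalars ℝ

theorem locallyIntegrableOn_comp {E : Type*} [NormedAddCommGroup E] [NormedSpace ℝ E]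
    (h : IsConformalHomeomorph φ Ω Ω')
    (hΩ : IsOpen Ω) (hΩ' : IsOpen Ω') {f : ℂ → E} (hf : LocallyIntegrableOn f Ω' volume) :
    LocallyIntegrableOn (fun z => f (φ z)) Ω volume := by
  rw [locallyIntegrableOn_iff hΩ.isLocallyClosed]
  intro K hK hKc
  have him : IntegrableOn f (φ '' K) volume := by
    rw [locallyIntegrableOn_iff hΩ'.isLocallyClosed] at hf
    exact hf _ (h.bijOn.mapsTo.image_subset.trans' (Set.image_mono hK))
      (hKc.image_of_continuousOn (h.differentiableOn.continuousOn.mono hK))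
  rw [integrableOn_image_iff_integrableOn_abs_det_fderiv_smul volume hKc.measurableSet
    (h.hasFDerivWithinAt hΩ hK) (h.bijOn.injOn.mono hK)] at him
  simp only [Complex.det_restrictScalars_toSpanSingleton, abs_pow, abs_norm] at him
  -- The Jacobian factor is removed by multiplying with `|φ'|⁻²`, which is continuous, hence
  -- bounded, on `K`.
  have hcont : ContinuousOn (fun z => (‖deriv φ z‖ ^ 2)⁻¹) K :=
    (((h.continuousOn_deriv hΩ).mono hK).norm.pow 2).inv₀ fun z hz => by
      simpa using h.deriv_ne_zero z (hK hz)
  refine (him.continuousOn_smul hcont hKc).congr_fun (fun z hz => ?_) hKc.measurableSet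
  have : ‖deriv φ z‖ ≠ 0 := by simpa using h.deriv_ne_zero z (hK hz)
  simp only [smul_smul]
  rw [inv_mul_cancel₀ (pow_ne_zero 2 this), one_smul]

end IsConformalHomeomorph

/-! ### Test functions and the weak chain rule -/

/-- A function smooth on an open set and vanishing off a compact subset of it is a test
function. -/
theorem ContDiffOn.testFunction {E : Type*} [NormedAddCommGroup E] [NormedSpace ℝ E]
    {F : ℂ → E} {U K : Set ℂ} (hU : IsOpen U) (hF : ContDiffOn ℝ ∞ F U)
    (hK : IsCompact K) (hKU : K ⊆ U) (h0 : ∀ z ∉ K, F z = 0) :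
    ContDiff ℝ ∞ F ∧ HasCompactSupport F ∧ tsupport F ⊆ U := by
  refine ⟨contDiff_iff_contDiffAt.2 fun z => ?_, HasCompactSupport.intro hK h0, ?_⟩
  · by_cases hz : z ∈ U
    · exact hF.contDiffAt (hU.mem_nhds hz)
    · have : F =ᶠ[nhds z] fun _ => 0 := by
        filter_upwards [hK.isClosed.isOpen_compl.mem_nhds fun h => hz (hKU h)] with w hw
        exact h0 w hw
      exact contDiffAt_const.congr_of_eventuallyEq this
  · refine (closure_minimal (fun z hz => ?_) hK.isClosed).trans hKU
    by_contra hzK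
    exact hz (h0 z hzK)

/-- The product of a locally integrable function with a compactly supported continuous function
is integrable. -/
theorem MeasureTheory.LocallyIntegrableOn.integrableOn_mul_testFunction {Ω : Set ℂ} {u ψ : ℂ → ℝ}
    (hu : LocallyIntegrableOn u Ω volume) (hψ : Continuous ψ) (hc : HasCompactSupport ψ)
    (hs : tsupport ψ ⊆ Ω) : IntegrableOn (fun z => u z * ψ z) Ω volume := by
  have hi : IntegrableOn (fun z => u z * ψ z) (tsupport ψ) volume :=
    (hu.integrableOn_compact_subset hs hc).mul_continuousOn hψ.continuousOn hc
  have : Integrable (fun z => u z * ψ z) volume := by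
    rw [← integrableOn_iff_integrable_of_support_subset (s := tsupport ψ)]
    · exact hi
    · intro z hz
      exact subset_tsupport _ fun h => hz (by simp [h])
  exact this.integrableOn

theorem MeasureTheory.LocallyIntegrableOn.clm_comp {E F : Type*} [NormedAddCommGroup E]
    [NormedSpace ℝ E] [NormedAddCommGroup F] [NormedSpace ℝ F] {Ω : Set ℂ} {g : ℂ → E}
    (hg : LocallyIntegrableOn g Ω volume) (L : E →L[ℝ] F) :
    LocallyIntegrableOn (fun z => L (g z)) Ω volume := fun x hx => by
  obtain ⟨s, hs, hi⟩ := hg x hx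
  exact ⟨s, hs, L.integrable_comp hi⟩

theorem tsupport_fderiv_apply_test {ψ : ℂ → ℝ} (hψ : ContDiff ℝ ∞ ψ) (hc : HasCompactSupport ψ)
    (v : ℂ) : Continuous (fun z => fderiv ℝ ψ z v) ∧ HasCompactSupport (fun z => fderiv ℝ ψ z v) ∧
      tsupport (fun z => fderiv ℝ ψ z v) ⊆ tsupport ψ :=
  ⟨(hψ.continuous_fderiv (by simp)).clm_apply continuous_const, hc.fderiv_apply ℝ v,
    tsupport_fderiv_apply_subset ℝ v⟩

namespace IsConformalHomeomorph

variable {φ η : ℂ → ℂ} {Ω Ω' : Set ℂ}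

/-- Transport of a test function `ψ` along a conformal map `η`, with the real linear
functional `a` of `η'` as a weight. -/
theorem exists_weighted_pullback (hφ : IsConformalHomeomorph φ Ω Ω')
    (hη : IsConformalHomeomorph η Ω' Ω) (hinv : Set.InvOn η φ Ω Ω') (hΩ' : IsOpen Ω')
    {ψ : ℂ → ℝ} (hψ : ContDiff ℝ ∞ ψ) (hc : HasCompactSupport ψ) (hs : tsupport ψ ⊆ Ω)
    (a : ℂ →L[ℝ] ℝ) :
    ∃ U : ℂ → ℝ, (ContDiff ℝ ∞ U ∧ HasCompactSupport U ∧ tsupport U ⊆ Ω') ∧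
      (∀ w ∈ Ω', U w = a (deriv η w) * ψ (η w)) ∧
      ∀ w ∈ Ω', ∀ v, fderiv ℝ U w v =
        a (deriv (deriv η) w * v) * ψ (η w) +
          a (deriv η w) * fderiv ℝ ψ (η w) (deriv η w * v) := by
  classical
  set V : ℂ → ℝ := fun w => a (deriv η w) * ψ (η w) with hV
  have hUV : Set.EqOn (Ω'.indicator V) V Ω' := fun w hw => Set.indicator_of_mem hw V
  refine ⟨Ω'.indicator V, ?_, hUV, ?_⟩
  · refine ContDiffOn.testFunction (K := φ '' tsupport ψ) hΩ' ?_
      (hc.isCompact.image_of_continuousOn (hφ.differentiableOn.continuousOn.mono hs))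
      (hφ.bijOn.mapsTo.image_subset.trans' (Set.image_mono hs)) ?_
    · refine ContDiffOn.congr ?_ hUV
      exact (a.contDiff.comp_contDiffOn (hη.contDiffOn_deriv hΩ')).mul
        (hψ.comp_contDiffOn (hη.contDiffOn hΩ'))
    · intro w hw
      by_cases hw' : w ∈ Ω'
      · rw [hUV hw']
        have : η w ∉ tsupport ψ := fun h => hw ⟨η w, h, hinv.2 hw'⟩
        simp [hV, image_eq_zero_of_notMem_tsupport this]
      · exact Set.indicator_of_notMem hw' V
  · intro w hw v
    have h1 : HasFDerivAt η _ w := (hη.hasDerivAt hΩ' hw).hasFDerivAt.restrictScalars ℝ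
    have h2 : HasFDerivAt (deriv η) _ w :=
      (((hη.differentiableOn.deriv hΩ').differentiableAt
        (hΩ'.mem_nhds hw)).hasDerivAt).hasFDerivAt.restrictScalars ℝ
    have h3 : HasFDerivAt ψ (fderiv ℝ ψ (η w)) (η w) :=
      (hψ.differentiable (by simp) _).hasFDerivAt
    have h4 := (a.hasFDerivAt.comp w h2).mul (h3.comp w h1)
    have h5 : fderiv ℝ (Ω'.indicator V) w = fderiv ℝ V w :=
      (hUV.eventuallyEq_of_mem (hΩ'.mem_nhds hw)).fderiv_eq
    have h6 : fderiv ℝ V w = _ := h4.fderiv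
    rw [h5, h6]
    simp [mul_comm]
    ring

end IsConformalHomeomorph

/-- Chain rule for weak gradients under conformal maps. -/
theorem HasWeakGradient.comp_conformal {φ : ℂ → ℂ} {Ω Ω' : Set ℂ}
    (hφ : IsConformalHomeomorph φ Ω Ω') (hΩ : IsOpen Ω) (hΩ' : IsOpen Ω') {f : ℂ → ℝ}
    {g : ℂ → ℂ} (hfg : HasWeakGradient Ω' f g) :
    HasWeakGradient Ω (f ∘ φ) (fun z => starRingEnd ℂ (deriv φ z) * g (φ z)) := by
  obtain ⟨η, hη, hinv, hder⟩ := hφ.exists_inverse hΩ hΩ'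
  -- Here `b` stands for `φ'`, `b⁻¹` for `η'` and `L` for the differential of the test function.
  -- Multiplication by `b⁻¹` is a rotation times a dilation, so these combinations recover the
  -- partial derivatives of `ψ` once the Jacobian `‖b‖²` is included.
  have hb : ∀ b : ℂ, b ≠ 0 → ∀ L : ℂ →L[ℝ] ℝ,
      ‖b‖ ^ 2 * (b⁻¹.re * L (b⁻¹ * 1) - b⁻¹.im * L (b⁻¹ * Complex.I)) = L 1 ∧
      ‖b‖ ^ 2 * (b⁻¹.im * L (b⁻¹ * 1) + b⁻¹.re * L (b⁻¹ * Complex.I)) = L Complex.I := by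
    intro b hb L
    have hn : Complex.normSq b ≠ 0 := by simpa using hb
    have h1 : b.re ^ 2 + b.im ^ 2 ≠ 0 := by simpa [Complex.normSq_apply, sq] using hn
    have h2 : b.im ^ 2 + b.re ^ 2 ≠ 0 := by rwa [add_comm]
    have hL : ∀ c : ℂ, L c = c.re * L 1 + c.im * L Complex.I := fun c => by
      have hc : c = c.re • (1 : ℂ) + c.im • Complex.I := by apply Complex.ext <;> simp
      conv_lhs => rw [hc, map_add, map_smul, map_smul, smul_eq_mul, smul_eq_mul]
    rw [hL (b⁻¹ * 1), hL (b⁻¹ * Complex.I), Complex.sq_norm]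
    constructor <;> simp only [Complex.normSq_apply, Complex.inv_re, Complex.inv_im,
      Complex.mul_re, Complex.mul_im, Complex.one_re, Complex.one_im, Complex.I_re,
      Complex.I_im, ← sq] <;> field_simp <;> ring
  have hre := hfg.locallyIntegrableOn_grad.clm_comp Complex.reCLM
  have him := hfg.locallyIntegrableOn_grad.clm_comp Complex.imCLM
  simp only [Complex.reCLM_apply, Complex.imCLM_apply] at hre him
  have main : ∀ ψ : ℂ → ℝ, ContDiff ℝ ∞ ψ → HasCompactSupport ψ → tsupport ψ ⊆ Ω →
      (∫ z in Ω, f (φ z) * fderiv ℝ ψ z 1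
        = -∫ z in Ω, (starRingEnd ℂ (deriv φ z) * g (φ z)).re * ψ z) ∧
      (∫ z in Ω, f (φ z) * fderiv ℝ ψ z Complex.I
        = -∫ z in Ω, (starRingEnd ℂ (deriv φ z) * g (φ z)).im * ψ z) := by
    intro ψ hψ hc hs
    -- The test functions on `Ω'` are `U = Re η' · ψ∘η` and `V = Im η' · ψ∘η`. By the Cauchy–Riemann
    -- equations for `η'`, the terms containing `η''` cancel in `∂ₓU - ∂ᵧV` and in `∂ₓV + ∂ᵧU`.
    obtain ⟨U, ⟨hU, hUc, hUs⟩, hUe, hUd⟩ :=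
      hφ.exists_weighted_pullback hη hinv hΩ' hψ hc hs Complex.reCLM
    obtain ⟨V, ⟨hV, hVc, hVs⟩, hVe, hVd⟩ :=
      hφ.exists_weighted_pullback hη hinv hΩ' hψ hc hs Complex.imCLM
    have iD : ∀ W : ℂ → ℝ, ContDiff ℝ ∞ W → HasCompactSupport W → tsupport W ⊆ Ω' → ∀ v : ℂ,
        IntegrableOn (fun w => f w * fderiv ℝ W w v) Ω' volume := fun W hW hWc hWs v =>
      have h := tsupport_fderiv_apply_test hW hWc v
      hfg.locallyIntegrableOn.integrableOn_mul_testFunction h.1 h.2.1 (h.2.2.trans hWs)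
    constructor
    · have e1 : ∫ z in Ω, f (φ z) * fderiv ℝ ψ z 1 =
          ∫ w in Ω', (f w * fderiv ℝ U w 1 - f w * fderiv ℝ V w Complex.I) := by
        rw [hφ.setIntegral_eq hΩ]
        refine setIntegral_congr_fun hΩ.measurableSet fun z hz => ?_
        have hz' := hφ.bijOn.mapsTo hz
        simp only [hUd _ hz', hVd _ hz', hder z hz, hinv.1 hz, Complex.reCLM_apply,
          Complex.imCLM_apply]
        rw [← (hb _ (hφ.deriv_ne_zero z hz) (fderiv ℝ ψ z)).1]
        simp
        ring
      -- `Re g · U - Im g · V` is `Re (g η') · ψ∘η`, and `|φ'|² η'∘φ = conj φ'`, which is where the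
      -- conjugate in the chain rule comes from.
      have e2 : ∫ z in Ω, (starRingEnd ℂ (deriv φ z) * g (φ z)).re * ψ z =
          ∫ w in Ω', ((g w).re * U w - (g w).im * V w) := by
        rw [hφ.setIntegral_eq hΩ]
        refine setIntegral_congr_fun hΩ.measurableSet fun z hz => ?_
        have hz' := hφ.bijOn.mapsTo hz
        have hn : Complex.normSq (deriv φ z) ≠ 0 := by simpa using hφ.deriv_ne_zero z hz
        simp only [hUe _ hz', hVe _ hz', hder z hz, hinv.1 hz, Complex.reCLM_apply,
          Complex.imCLM_apply, Complex.sq_norm, Complex.inv_re, Complex.inv_im, Complex.mul_re,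
          Complex.conj_re, Complex.conj_im]
        field_simp
      rw [e1, e2, integral_sub (iD U hU hUc hUs 1) (iD V hV hVc hVs _),
        integral_sub (hre.integrableOn_mul_testFunction hU.continuous hUc hUs)
          (him.integrableOn_mul_testFunction hV.continuous hVc hVs),
        hfg.integral_dx U hU hUc hUs, hfg.integral_dy V hV hVc hVs]
      ring
    · have e1 : ∫ z in Ω, f (φ z) * fderiv ℝ ψ z Complex.I =
          ∫ w in Ω', (f w * fderiv ℝ V w 1 + f w * fderiv ℝ U w Complex.I) := by
        rw [hφ.setIntegral_eq hΩ]
        refine setIntegral_congr_fun hΩ.measurableSet fun z hz => ?_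
        have hz' := hφ.bijOn.mapsTo hz
        simp only [hUd _ hz', hVd _ hz', hder z hz, hinv.1 hz, Complex.reCLM_apply,
          Complex.imCLM_apply]
        rw [← (hb _ (hφ.deriv_ne_zero z hz) (fderiv ℝ ψ z)).2]
        simp
        ring
      have e2 : ∫ z in Ω, (starRingEnd ℂ (deriv φ z) * g (φ z)).im * ψ z =
          ∫ w in Ω', ((g w).re * V w + (g w).im * U w) := by
        rw [hφ.setIntegral_eq hΩ]
        refine setIntegral_congr_fun hΩ.measurableSet fun z hz => ?_
        have hz' := hφ.bijOn.mapsTo hz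
        have hn : Complex.normSq (deriv φ z) ≠ 0 := by simpa using hφ.deriv_ne_zero z hz
        simp only [hUe _ hz', hVe _ hz', hder z hz, hinv.1 hz, Complex.reCLM_apply,
          Complex.imCLM_apply, Complex.sq_norm, Complex.inv_re, Complex.inv_im, Complex.mul_im,
          Complex.conj_re, Complex.conj_im]
        field_simp
        ring
      rw [e1, e2, integral_add (iD V hV hVc hVs 1) (iD U hU hUc hUs _),
        integral_add (hre.integrableOn_mul_testFunction hV.continuous hVc hVs)
          (him.integrableOn_mul_testFunction hU.continuous hUc hUs),
        hfg.integral_dx V hV hVc hVs, hfg.integral_dy U hU hUc hUs]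
      ring
  refine ⟨hφ.locallyIntegrableOn_comp hΩ hΩ' hfg.locallyIntegrableOn, ?_,
    fun ψ hψ hc hs => (main ψ hψ hc hs).1, fun ψ hψ hc hs => (main ψ hψ hc hs).2⟩
  have hcomp := hφ.locallyIntegrableOn_comp hΩ hΩ' hfg.locallyIntegrableOn_grad
  rw [locallyIntegrableOn_iff hΩ.isLocallyClosed] at hcomp ⊢
  intro K hK hKc
  exact (hcomp K hK hKc).continuousOn_mul
    (Complex.continuous_conj.comp_continuousOn ((hφ.continuousOn_deriv hΩ).mono hK)) hKc

/-! ### Classical gradients and the seminorm as an `L^s` norm -/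

/-- The gradient of a real function on `ℂ`, recorded as the complex number `∂F/∂x + i ∂F/∂y`. -/
noncomputable def complexGradient (F : ℂ → ℝ) (z : ℂ) : ℂ :=
  ⟨fderiv ℝ F z 1, fderiv ℝ F z Complex.I⟩

theorem continuous_complexGradient {F : ℂ → ℝ} (hF : ContDiff ℝ ∞ F) :
    Continuous (complexGradient F) := by
  have h : ∀ v : ℂ, Continuous (fun z => fderiv ℝ F z v) := fun v =>
    (hF.continuous_fderiv (by simp)).clm_apply continuous_const
  have : complexGradient F = fun z =>
      ((fderiv ℝ F z 1 : ℝ) : ℂ) + (fderiv ℝ F z Complex.I : ℝ) * Complex.I :=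
    funext fun z => (Complex.mk_eq_add_mul_I _ _)
  rw [this]
  exact (Complex.continuous_ofReal.comp (h 1)).add
    ((Complex.continuous_ofReal.comp (h Complex.I)).mul continuous_const)

theorem hasWeakGradient_complexGradient {Ω : Set ℂ} {F : ℂ → ℝ} (hF : ContDiff ℝ ∞ F) :
    HasWeakGradient Ω F (complexGradient F) := by
  have key : ∀ (v : ℂ) (ψ : ℂ → ℝ), ContDiff ℝ ∞ ψ → HasCompactSupport ψ → tsupport ψ ⊆ Ω →
      ∫ z in Ω, F z * fderiv ℝ ψ z v = -∫ z in Ω, fderiv ℝ F z v * ψ z := by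
    intro v ψ hψ hc hs
    have h := tsupport_fderiv_apply_test hψ hc v
    have hFv : Continuous (fun z => fderiv ℝ F z v) :=
      (hF.continuous_fderiv (by simp)).clm_apply continuous_const
    rw [setIntegral_eq_integral_of_forall_compl_eq_zero,
      setIntegral_eq_integral_of_forall_compl_eq_zero]
    · refine integral_mul_fderiv_eq_neg_fderiv_mul_of_integrable ?_ ?_ ?_
        (fun _ _ => hF.differentiable (by simp) _) (fun _ _ => hψ.differentiable (by simp) _)
      · exact (hFv.mul hψ.continuous).integrable_of_hasCompactSupport hc.mul_left
      · exact (hF.continuous.mul h.1).integrable_of_hasCompactSupport h.2.1.mul_left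
      · exact (hF.continuous.mul hψ.continuous).integrable_of_hasCompactSupport hc.mul_left
    · intro z hz
      rw [image_eq_zero_of_notMem_tsupport fun h => hz (hs h), mul_zero]
    · intro z hz
      have : (fun z => fderiv ℝ ψ z v) z = 0 :=
        image_eq_zero_of_notMem_tsupport (f := fun z => fderiv ℝ ψ z v) fun h' => hz (hs (h.2.2 h'))
      simp only at this
      rw [this, mul_zero]
  exact ⟨hF.continuous.locallyIntegrable.locallyIntegrableOn _,
    (continuous_complexGradient hF).locallyIntegrable.locallyIntegrableOn _, key 1, key Complex.I⟩

/-- Almost everywhere uniqueness of the weak gradient frees the seminorm from the arbitrary choice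
in its definition; all later computations use an explicit gradient. -/
theorem HasWeakGradient.homSobolevSeminorm_eq {Ω : Set ℂ} (hΩ : IsOpen Ω) {f : ℂ → ℝ} {g : ℂ → ℂ}
    (h : HasWeakGradient Ω f g) (s : ℝ) :
    homSobolevSeminorm s Ω f = (∫⁻ z in Ω, ENNReal.ofReal (‖g z‖ ^ s)) ^ (1 / s) := by
  have hw : WeaklyDifferentiable Ω f := ⟨g, h⟩
  have hg : HasWeakGradient Ω f (weakGradient Ω f) := by
    rw [weakGradient, dif_pos hw]
    exact hw.choose_spec
  rw [homSobolevSeminorm]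
  congr 1
  refine lintegral_congr_ae ?_
  filter_upwards [hg.ae_eq hΩ h] with z hz
  rw [hz]

theorem MeasureTheory.eLpNorm_ofReal_eq_lintegral {α E : Type*} [MeasurableSpace α]
    [NormedAddCommGroup E] {μ : Measure α} (g : α → E) {s : ℝ} (hs : 0 < s) :
    eLpNorm g (ENNReal.ofReal s) μ = (∫⁻ z, ENNReal.ofReal (‖g z‖ ^ s) ∂μ) ^ (1 / s) := by
  rw [eLpNorm_eq_lintegral_rpow_enorm_toReal (by simpa using hs)
    ENNReal.ofReal_ne_top, ENNReal.toReal_ofReal hs.le]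
  congr 1
  refine lintegral_congr fun z => ?_
  rw [← ofReal_norm, ENNReal.ofReal_rpow_of_nonneg (norm_nonneg _) hs.le]

theorem HasWeakGradient.homSobolevSeminorm_eq_eLpNorm {Ω : Set ℂ} (hΩ : IsOpen Ω) {f : ℂ → ℝ}
    {g : ℂ → ℂ} (h : HasWeakGradient Ω f g) {s : ℝ} (hs : 0 < s) :
    homSobolevSeminorm s Ω f = eLpNorm g (ENNReal.ofReal s) (volume.restrict Ω) := by
  rw [h.homSobolevSeminorm_eq hΩ, eLpNorm_ofReal_eq_lintegral g hs]

/-! ### Sufficiency: Hölder's inequality -/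

/-- Hölder estimate for the pulled back gradient. -/
theorem IsConformalHomeomorph.lintegral_pullback_grad_le {φ : ℂ → ℂ} {Ω Ω' : Set ℂ}
    (hφ : IsConformalHomeomorph φ Ω Ω') (hΩ : IsOpen Ω) {g : ℂ → ℂ}
    (hm : AEStronglyMeasurable (fun z => starRingEnd ℂ (deriv φ z) * g (φ z)) (volume.restrict Ω))
    {p q : ℝ} (hq : 0 < q) (hqp : q < p) :
    ∫⁻ z in Ω, ENNReal.ofReal (‖starRingEnd ℂ (deriv φ z) * g (φ z)‖ ^ q) ≤
      (∫⁻ w in Ω', ENNReal.ofReal (‖g w‖ ^ p)) ^ (q / p) *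
        (∫⁻ z in Ω, ENNReal.ofReal (‖deriv φ z‖ ^ ((p - 2) * q / (p - q)))) ^ ((p - q) / p) := by
  have hp : 0 < p := hq.trans hqp
  have hpq : 0 < p - q := sub_pos.2 hqp
  have hpos : ∀ z ∈ Ω, 0 < ‖deriv φ z‖ := fun z hz => norm_pos_iff.2 (hφ.deriv_ne_zero z hz)
  have hdm : AEMeasurable (fun z => ‖deriv φ z‖) (volume.restrict Ω) :=
    (hφ.continuousOn_deriv hΩ).norm.aemeasurable hΩ.measurableSet
  rw [hφ.setLIntegral_eq hΩ]
  -- The Jacobian is split as `|φ'|² = |φ'|^p |φ'|^(2-p)`, the first factor completing the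
  -- pulled-back gradient. In Hölder's inequality with weights `q/p` and `(p-q)/p`, the remaining
  -- powers of `|φ'|` cancel (`e2` below).
  have hA : ∫⁻ z in Ω, ENNReal.ofReal (‖deriv φ z‖ ^ 2) * ENNReal.ofReal (‖g (φ z)‖ ^ p) =
      ∫⁻ z in Ω, ENNReal.ofReal
        (‖starRingEnd ℂ (deriv φ z) * g (φ z)‖ ^ p * ‖deriv φ z‖ ^ (2 - p)) := by
    refine setLIntegral_congr_fun hΩ.measurableSet fun z hz => ?_
    rw [← ENNReal.ofReal_mul (by positivity), norm_mul, RCLike.norm_conj,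
      Real.mul_rpow (norm_nonneg _) (norm_nonneg _), Real.rpow_sub (hpos z hz), Real.rpow_two]
    have := (Real.rpow_pos_of_pos (hpos z hz) p).ne'
    congr 1
    field_simp
  rw [hA]
  refine le_trans (le_of_eq ?_) (ENNReal.lintegral_mul_norm_pow_le ?_ ?_ (by positivity)
    (by positivity) (by field_simp; ring))
  · refine setLIntegral_congr_fun hΩ.measurableSet fun z hz => ?_
    have h := hpos z hz
    rw [ENNReal.ofReal_rpow_of_nonneg (by positivity) (by positivity),
      ENNReal.ofReal_rpow_of_nonneg (by positivity) (by positivity),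
      ← ENNReal.ofReal_mul (by positivity), Real.mul_rpow (by positivity) (by positivity),
      ← Real.rpow_mul (norm_nonneg _), ← Real.rpow_mul h.le, ← Real.rpow_mul h.le, mul_assoc,
      ← Real.rpow_add h]
    have e1 : p * (q / p) = q := by field_simp
    have e2 : (2 - p) * (q / p) + (p - 2) * q / (p - q) * ((p - q) / p) = 0 := by
      field_simp
      ring
    rw [e1, e2, Real.rpow_zero, mul_one]
  · exact ((hm.norm.aemeasurable.pow_const _).mul (hdm.pow_const _)).ennreal_ofReal
  · exact (hdm.pow_const _).ennreal_ofReal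

theorem IsConformalHomeomorph.inducesBoundedComposition {φ : ℂ → ℂ} {Ω Ω' : Set ℂ}
    (hφ : IsConformalHomeomorph φ Ω Ω') (hΩ : IsOpen Ω) (hΩ' : IsOpen Ω')
    {p q : ℝ} (hq : 0 < q) (hqp : q < p)
    (hfin : (∫⁻ z in Ω, ENNReal.ofReal (‖deriv φ z‖ ^ ((p - 2) * q / (p - q))))
        ^ ((p - q) / (p * q)) < (⊤ : ℝ≥0∞)) :
    InducesBoundedComposition φ Ω Ω' p q := by
  have hp : 0 < p := hq.trans hqp
  set A := (∫⁻ z in Ω, ENNReal.ofReal (‖deriv φ z‖ ^ ((p - 2) * q / (p - q))))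
    ^ ((p - q) / (p * q)) with hA
  have key : ∀ f : ℂ → ℝ, MemHomSobolev p Ω' f → WeaklyDifferentiable Ω (f ∘ φ) ∧
      homSobolevSeminorm q Ω (f ∘ φ) ≤ A.toNNReal * homSobolevSeminorm p Ω' f := by
    rintro f ⟨⟨g, hg⟩, -⟩
    have hG := hg.comp_conformal hφ hΩ hΩ'
    refine ⟨⟨_, hG⟩, ?_⟩
    rw [hG.homSobolevSeminorm_eq hΩ, hg.homSobolevSeminorm_eq hΩ', ENNReal.coe_toNNReal hfin.ne]
    refine (ENNReal.rpow_le_rpow (hφ.lintegral_pullback_grad_le hΩ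
      hG.locallyIntegrableOn_grad.aestronglyMeasurable hq hqp) (by positivity)).trans_eq ?_
    rw [ENNReal.mul_rpow_of_nonneg _ _ (by positivity), ← ENNReal.rpow_mul, ← ENNReal.rpow_mul,
      mul_comm, hA]
    congr 2 <;> field_simp
  refine ⟨fun f hf => ⟨(key f hf).1, (key f hf).2.trans_lt ?_⟩, A.toNNReal,
    fun f hf => (key f hf).2⟩
  exact ENNReal.mul_lt_top ENNReal.coe_lt_top hf.2

/-! ### Necessity: from gradients to arbitrary functions by oscillation -/

theorem memLp_complexGradient {F : ℂ → ℝ} (hF : ContDiff ℝ ∞ F) (hc : HasCompactSupport F)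
    (s : ℝ≥0∞) (Ω : Set ℂ) : MemLp (complexGradient F) s (volume.restrict Ω) := by
  refine ((continuous_complexGradient hF).memLp_of_hasCompactSupport
    (HasCompactSupport.intro hc fun z hz => ?_)).restrict Ω
  have h := fun v => tsupport_fderiv_apply_test hF hc v
  have h0 : ∀ v, fderiv ℝ F z v = 0 := fun v =>
    image_eq_zero_of_notMem_tsupport (f := fun z => fderiv ℝ F z v) fun h' => hz ((h v).2.2 h')
  exact Complex.ext (h0 1) (h0 Complex.I)

/-- A bounded composition operator, applied to a compactly supported smooth function. -/
theorem InducesBoundedComposition.exists_eLpNorm_le {φ : ℂ → ℂ} {Ω Ω' : Set ℂ}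
    (hφ : IsConformalHomeomorph φ Ω Ω') (hΩ : IsOpen Ω) (hΩ' : IsOpen Ω') {p q : ℝ}
    (hp : 0 < p) (hq : 0 < q) (h : InducesBoundedComposition φ Ω Ω' p q) :
    ∃ K : ℝ≥0, ∀ F : ℂ → ℝ, ContDiff ℝ ∞ F → HasCompactSupport F →
      eLpNorm (fun z => starRingEnd ℂ (deriv φ z) * complexGradient F (φ z)) (ENNReal.ofReal q)
        (volume.restrict Ω) ≤
      K * eLpNorm (complexGradient F) (ENNReal.ofReal p) (volume.restrict Ω') := by
  obtain ⟨-, K, hK⟩ := h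
  refine ⟨K, fun F hF hc => ?_⟩
  have hw : HasWeakGradient Ω' F (complexGradient F) := hasWeakGradient_complexGradient hF
  have := hK F ⟨⟨_, hw⟩, by
    rw [hw.homSobolevSeminorm_eq_eLpNorm hΩ' hp]
    exact (memLp_complexGradient hF hc _ _).eLpNorm_lt_top⟩
  rwa [hw.homSobolevSeminorm_eq_eLpNorm hΩ' hp,
    (hw.comp_conformal hφ hΩ hΩ').homSobolevSeminorm_eq_eLpNorm hΩ hq] at this

/-- A rapidly oscillating function of small amplitude `ε` with envelope `θ`. -/
noncomputable def sineWave (ε c : ℝ) (θ : ℂ → ℝ) (w : ℂ) : ℝ :=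
  θ w * (ε * Real.sin (w.re / ε + c))

theorem contDiff_sineWave {ε c : ℝ} {θ : ℂ → ℝ} (hθ : ContDiff ℝ ∞ θ) :
    ContDiff ℝ ∞ (sineWave ε c θ) := by
  have : ContDiff ℝ ∞ (fun w : ℂ => w.re) := Complex.reCLM.contDiff
  exact hθ.mul (contDiff_const.mul (Real.contDiff_sin.comp ((this.div_const ε).add contDiff_const)))

theorem complexGradient_sineWave {ε c : ℝ} (hε : ε ≠ 0) {θ : ℂ → ℝ} (hθ : ContDiff ℝ ∞ θ)
    (w : ℂ) : complexGradient (sineWave ε c θ) w =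
      ((ε * Real.sin (w.re / ε + c) : ℝ) : ℂ) * complexGradient θ w +
        ((θ w * Real.cos (w.re / ε + c) : ℝ) : ℂ) := by
  have h1 : HasFDerivAt θ (fderiv ℝ θ w) w := (hθ.differentiable (by simp) w).hasFDerivAt
  have h2 : HasFDerivAt (fun w : ℂ => w.re) Complex.reCLM w := Complex.reCLM.hasFDerivAt
  have h3 := h1.mul ((((h2.mul_const ε⁻¹).add_const c).sin).const_mul ε)
  have h4 : fderiv ℝ (sineWave ε c θ) w = _ := HasFDerivAt.fderiv h3
  apply Complex.ext
  · simp only [complexGradient, h4]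
    simp [← div_eq_mul_inv, -Complex.ofReal_sin, -Complex.ofReal_cos, -Complex.ofReal_mul]
    field_simp
    ring
  · simp only [complexGradient, h4]
    simp [← div_eq_mul_inv, -Complex.ofReal_sin, -Complex.ofReal_cos, -Complex.ofReal_mul]

theorem norm_complexGradient_sineWave_le {ε c : ℝ} (hε : 0 < ε) {θ : ℂ → ℝ}
    (hθ : ContDiff ℝ ∞ θ) (w : ℂ) :
    ‖complexGradient (sineWave ε c θ) w‖ ≤ ‖θ w‖ + ε * ‖complexGradient θ w‖ := by
  rw [complexGradient_sineWave hε.ne' hθ, add_comm]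
  refine (norm_add_le _ _).trans (add_le_add ?_ ?_)
  · rw [Complex.norm_real, norm_mul]
    exact mul_le_of_le_one_right (norm_nonneg _) (Real.abs_cos_le_one _)
  · rw [norm_mul, Complex.norm_real, norm_mul, Real.norm_of_nonneg hε.le]
    gcongr
    exact mul_le_of_le_one_right hε.le (Real.abs_sin_le_one _)

/-- A single wave loses information where its cosine vanishes. A phase shift of `π / 2` turns cosine
into minus sine, and `|cos| + |sin| ≥ 1`, so the two waves together dominate the envelope up to an
error of order `ε`. -/
theorem le_norm_complexGradient_sineWave {ε : ℝ} (hε : 0 < ε) {θ : ℂ → ℝ}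
    (hθ : ContDiff ℝ ∞ θ) (w : ℂ) :
    ‖θ w‖ ≤ ‖complexGradient (sineWave ε 0 θ) w‖ +
      ‖complexGradient (sineWave ε (Real.pi / 2) θ) w‖ + 2 * ε * ‖complexGradient θ w‖ := by
  have key : ∀ c, ‖θ w‖ * |Real.cos (w.re / ε + c)| ≤
      ‖complexGradient (sineWave ε c θ) w‖ + ε * ‖complexGradient θ w‖ := by
    intro c
    rw [complexGradient_sineWave hε.ne' hθ]
    set b : ℂ := ((ε * Real.sin (w.re / ε + c) : ℝ) : ℂ) * complexGradient θ w with hb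
    have h1 : ‖b‖ ≤ ε * ‖complexGradient θ w‖ := by
      rw [hb, norm_mul, Complex.norm_real, norm_mul, Real.norm_of_nonneg hε.le]
      gcongr
      exact mul_le_of_le_one_right hε.le (Real.abs_sin_le_one _)
    have h2 := norm_sub_le (b + ((θ w * Real.cos (w.re / ε + c) : ℝ) : ℂ)) b
    rw [add_sub_cancel_left, Complex.norm_real, norm_mul] at h2
    exact h2.trans (by gcongr)
  have h0 := key 0
  have h1 := key (Real.pi / 2)
  rw [Real.cos_add_pi_div_two, abs_neg] at h1
  rw [add_zero] at h0
  have h2 : 1 ≤ |Real.cos (w.re / ε)| + |Real.sin (w.re / ε)| := by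
    have hs := Real.sin_sq_add_cos_sq (w.re / ε)
    rw [← sq_abs (Real.sin _), ← sq_abs (Real.cos _)] at hs
    nlinarith [abs_nonneg (Real.sin (w.re / ε)), abs_nonneg (Real.cos (w.re / ε))]
  nlinarith [mul_le_mul_of_nonneg_left h2 (norm_nonneg (θ w))]

/-- A gradient estimate implies the same estimate, up to a factor `2`, with the
gradient replaced by an arbitrary test function. -/
theorem eLpNorm_weighted_le_of_gradient_le {φ : ℂ → ℂ} {Ω Ω' : Set ℂ}
    (hφ : IsConformalHomeomorph φ Ω Ω') (hΩ : IsOpen Ω) {p q : ℝ≥0∞}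
    (hp : 1 ≤ p) (hq : 1 ≤ q) {K : ℝ≥0}
    (hK : ∀ F : ℂ → ℝ, ContDiff ℝ ∞ F → HasCompactSupport F →
      eLpNorm (fun z => starRingEnd ℂ (deriv φ z) * complexGradient F (φ z)) q
        (volume.restrict Ω) ≤ K * eLpNorm (complexGradient F) p (volume.restrict Ω'))
    {θ : ℂ → ℝ} (hθ : ContDiff ℝ ∞ θ) (hc : HasCompactSupport θ) :
    eLpNorm (fun z => ‖deriv φ z‖ * θ (φ z)) q (volume.restrict Ω) ≤
      2 * K * eLpNorm θ p (volume.restrict Ω') := by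
  set G : (ℂ → ℝ) → ℂ → ℝ := fun F z => ‖deriv φ z‖ * ‖complexGradient F (φ z)‖ with hG
  have hGm : ∀ F, ContDiff ℝ ∞ F → AEStronglyMeasurable (G F) (volume.restrict Ω) := by
    intro F hF
    refine ContinuousOn.aestronglyMeasurable ?_ hΩ.measurableSet
    exact (hφ.continuousOn_deriv hΩ).norm.mul
      ((continuous_complexGradient hF).comp_continuousOn hφ.differentiableOn.continuousOn).norm
  have hGK : ∀ F, ContDiff ℝ ∞ F → HasCompactSupport F → eLpNorm (G F) q (volume.restrict Ω) ≤
      K * eLpNorm (complexGradient F) p (volume.restrict Ω') := by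
    intro F hF hFc
    refine le_trans (le_of_eq ?_) (hK F hF hFc)
    refine eLpNorm_congr_norm_ae (Filter.Eventually.of_forall fun z => ?_)
    simp [hG]
  set M := eLpNorm (complexGradient θ) p (volume.restrict Ω') with hM
  have hMtop : M ≠ ⊤ := (memLp_complexGradient hθ hc _ _).eLpNorm_ne_top
  have hscale : ∀ {E : Type} [NormedAddCommGroup E] (H : ℂ → E) (r : ℝ≥0∞) (μ : Measure ℂ) (a : ℝ≥0),
      eLpNorm (fun w => (a : ℝ) * ‖H w‖) r μ = a * eLpNorm H r μ := by
    intro E _ H r μ a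
    have := eLpNorm_const_smul (a : ℝ) (fun w => ‖H w‖) r μ
    rw [eLpNorm_norm] at this
    simpa [Pi.smul_def, enorm_eq_nnnorm] using this
  have hosc : ∀ (ε : ℝ≥0), 0 < ε → ∀ c : ℝ,
      eLpNorm (complexGradient (sineWave ε c θ)) p (volume.restrict Ω') ≤
        eLpNorm θ p (volume.restrict Ω') + ε * M := by
    intro ε hε c
    refine (eLpNorm_mono_real (norm_complexGradient_sineWave_le (by exact_mod_cast hε) hθ)).trans
      ((eLpNorm_add_le hθ.continuous.norm.aestronglyMeasurable
        (continuous_const.mul (continuous_complexGradient hθ).norm).aestronglyMeasurable hp).trans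
        (le_of_eq ?_))
    rw [eLpNorm_norm]
    exact congrArg _ (hscale _ _ _ _)
  -- Each of the two phases contributes one `K`, hence the constant `2 * K`. The error involves the
  -- gradient of `θ`, which does not depend on `ε`, so it vanishes in the limit.
  have hstep : ∀ ε : ℝ≥0, 0 < ε →
      eLpNorm (fun z => ‖deriv φ z‖ * θ (φ z)) q (volume.restrict Ω) ≤
        2 * K * eLpNorm θ p (volume.restrict Ω') + ε * (4 * K * M) := by
    intro ε hε
    have hF : ∀ c, ContDiff ℝ ∞ (sineWave ε c θ) := fun c => contDiff_sineWave hθ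
    have hFc : ∀ c, HasCompactSupport (sineWave ε c θ) := fun c => hc.mul_right
    have hpt : ∀ z, ‖‖deriv φ z‖ * θ (φ z)‖ ≤ G (sineWave ε 0 θ) z +
        G (sineWave ε (Real.pi / 2) θ) z + ((2 * ε : ℝ≥0) : ℝ) * ‖G θ z‖ := by
      intro z
      have h := mul_le_mul_of_nonneg_left
        (le_norm_complexGradient_sineWave (ε := ε) (by exact_mod_cast hε) hθ (φ z))
        (norm_nonneg (deriv φ z))
      have h' : ‖G θ z‖ = ‖deriv φ z‖ * ‖complexGradient θ (φ z)‖ :=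
        Real.norm_of_nonneg (by positivity)
      rw [h', norm_mul, norm_norm]
      push_cast
      simp only [hG]
      linarith
    refine (eLpNorm_mono_real hpt).trans ((eLpNorm_add_le ((hGm _ (hF _)).add (hGm _ (hF _)))
      ((hGm θ hθ).norm.const_mul _) hq).trans ((add_le_add (eLpNorm_add_le (hGm _ (hF _))
        (hGm _ (hF _)) hq) le_rfl).trans ?_))
    rw [hscale]
    calc _ ≤ K * (eLpNorm θ p (volume.restrict Ω') + ε * M) +
          K * (eLpNorm θ p (volume.restrict Ω') + ε * M) + (2 * ε : ℝ≥0) * (K * M) := by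
          gcongr
          · exact (hGK _ (hF _) (hFc _)).trans (by gcongr; exact hosc ε hε _)
          · exact (hGK _ (hF _) (hFc _)).trans (by gcongr; exact hosc ε hε _)
          · exact hGK θ hθ hc
      _ = _ := by push_cast; ring
  have hlim : Filter.Tendsto (fun ε : ℝ≥0 => 2 * K * eLpNorm θ p (volume.restrict Ω') +
      (ε : ℝ≥0∞) * (4 * K * M)) (nhdsWithin 0 (Set.Ioi 0))
      (nhds (2 * K * eLpNorm θ p (volume.restrict Ω') + ((0 : ℝ≥0) : ℝ≥0∞) * (4 * K * M))) := by
    refine Filter.Tendsto.mono_left ?_ nhdsWithin_le_nhds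
    refine tendsto_const_nhds.add (ENNReal.Tendsto.mul_const ?_ (Or.inr ?_))
    · exact ENNReal.tendsto_coe.2 Filter.tendsto_id
    · exact ENNReal.mul_ne_top (ENNReal.mul_ne_top (by simp) (by simp)) hMtop
  rw [ENNReal.coe_zero, zero_mul, add_zero] at hlim
  exact ge_of_tendsto hlim (eventually_nhdsWithin_of_forall hstep)

/-! ### Necessity: the extremal function and exhaustion by compact sets -/

/-- A smooth cutoff function, equal to `1` on a compact set and supported in a compact subset of
a given neighbourhood. -/
theorem exists_smooth_cutoff {K U : Set ℂ} (hK : IsCompact K) (hU : IsOpen U) (hKU : K ⊆ U) :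
    ∃ (χ : ℂ → ℝ) (L : Set ℂ), ContDiff ℝ ∞ χ ∧ IsCompact L ∧ L ⊆ U ∧
      (∀ z, χ z ∈ Set.Icc (0 : ℝ) 1) ∧ (∀ z ∈ K, χ z = 1) ∧ ∀ z ∉ L, χ z = 0 := by
  obtain ⟨L, hL, hKL, hLU⟩ := exists_compact_between hK hU hKU
  obtain ⟨χ, hχ, hr, h0, h1⟩ := exists_contMDiff_zero_iff_one_iff_of_isClosed
    (modelWithCornersSelf ℝ ℂ) (n := ⊤) (isOpen_interior (s := L)).isClosed_compl hK.isClosed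
    (Set.disjoint_left.2 fun z hz hzK => hz (hKL hzK))
  exact ⟨χ, L, hχ.contDiff, hL, hLU, fun z => hr ⟨z, rfl⟩, fun z hz => (h1 z).1 hz,
    fun z hz => (h0 z).1 fun h => hz (interior_subset h)⟩

/-- Uniform bound for the integral of `‖φ'‖ ^ ((p - 2) * q / (p - q))` over compact sets. -/
theorem IsConformalHomeomorph.setLIntegral_compact_le {φ : ℂ → ℂ} {Ω Ω' : Set ℂ}
    (hφ : IsConformalHomeomorph φ Ω Ω') (hΩ : IsOpen Ω) (hΩ' : IsOpen Ω') {p q : ℝ}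
    (hq : 0 < q) (hqp : q < p) {C : ℝ≥0∞}
    (hC : ∀ θ : ℂ → ℝ, ContDiff ℝ ∞ θ → HasCompactSupport θ →
      eLpNorm (fun z => ‖deriv φ z‖ * θ (φ z)) (ENNReal.ofReal q) (volume.restrict Ω) ≤
        C * eLpNorm θ (ENNReal.ofReal p) (volume.restrict Ω'))
    {K : Set ℂ} (hK : IsCompact K) (hKΩ : K ⊆ Ω) :
    (∫⁻ z in K, ENNReal.ofReal (‖deriv φ z‖ ^ ((p - 2) * q / (p - q)))) ^ ((p - q) / (p * q))
      ≤ C := by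
  have hp : 0 < p := hq.trans hqp
  have hpq : 0 < p - q := sub_pos.2 hqp
  obtain ⟨η, hη, hinv, hder⟩ := hφ.exists_inverse hΩ hΩ'
  obtain ⟨χ, L, hχ, hL, hLΩ', hχI, hχ1, hχ0⟩ := exists_smooth_cutoff
    (hK.image_of_continuousOn (hφ.differentiableOn.continuousOn.mono hKΩ)) hΩ'
    (hφ.bijOn.mapsTo.image_subset.trans' (Set.image_mono hKΩ))
  -- The exponent `a` solves `2 + a p = q + a q`: for `θ∘φ = |φ'|^a` the densities `|φ'|² |θ∘φ|^p`
  -- and `(|φ'| |θ∘φ|)^q` are both `|φ'|^s`. On `Ω'` this function is `|η'|^(-a)`, smooth because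
  -- `η'` does not vanish.
  set a : ℝ := (q - 2) / (p - q) with ha
  set s : ℝ := (p - 2) * q / (p - q) with hs
  set θ : ℂ → ℝ := fun w => χ w * ‖deriv η w‖ ^ (-a) with hθ
  obtain ⟨hθs, hθc, -⟩ : ContDiff ℝ ∞ θ ∧ HasCompactSupport θ ∧ tsupport θ ⊆ Ω' := by
    refine ContDiffOn.testFunction hΩ' ?_ hL hLΩ' fun z hz => by simp [hθ, hχ0 z hz]
    exact hχ.contDiffOn.mul (((hη.contDiffOn_deriv hΩ').norm ℝ hη.deriv_ne_zero).rpow_const_of_ne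
      fun w hw => norm_ne_zero_iff.2 (hη.deriv_ne_zero w hw))
  have hpos : ∀ z ∈ Ω, 0 < ‖deriv φ z‖ := fun z hz => norm_pos_iff.2 (hφ.deriv_ne_zero z hz)
  have hθφ : ∀ z ∈ Ω, θ (φ z) = χ (φ z) * ‖deriv φ z‖ ^ a := by
    intro z hz
    simp only [hθ, hder z hz, norm_inv]
    rw [Real.inv_rpow (norm_nonneg _), Real.rpow_neg (norm_nonneg _), inv_inv]
  have hfin : eLpNorm θ (ENNReal.ofReal p) (volume.restrict Ω') < ⊤ :=
    ((hθs.continuous.memLp_of_hasCompactSupport hθc).restrict Ω').eLpNorm_lt_top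
  have hmain := hC θ hθs hθc
  rw [eLpNorm_ofReal_eq_lintegral _ hp] at hfin hmain
  rw [eLpNorm_ofReal_eq_lintegral _ hq] at hmain
  set A := ∫⁻ w in Ω', ENNReal.ofReal (‖θ w‖ ^ p) with hA
  have hA' : A = ∫⁻ z in Ω, ENNReal.ofReal (χ (φ z) ^ p * ‖deriv φ z‖ ^ s) := by
    rw [hA, hφ.setLIntegral_eq hΩ]
    refine setLIntegral_congr_fun hΩ.measurableSet fun z hz => ?_
    have h := hpos z hz
    have hc := (hχI (φ z)).1
    have e : 2 + a * p = s := by rw [ha, hs]; field_simp; ring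
    rw [hθφ z hz, ← ENNReal.ofReal_mul (by positivity), Real.norm_of_nonneg (by positivity),
      Real.mul_rpow hc (by positivity), ← Real.rpow_mul h.le, mul_left_comm, ← Real.rpow_two,
      ← Real.rpow_add h, e]
  -- The two densities differ only by `χ^p` against `χ^q`, and `χ^p ≤ χ^q` since `0 ≤ χ ≤ 1` and `q
  -- < p`.
  have hB : A ≤ ∫⁻ z in Ω, ENNReal.ofReal (‖‖deriv φ z‖ * θ (φ z)‖ ^ q) := by
    rw [hA']
    refine setLIntegral_mono' hΩ.measurableSet fun z hz => ENNReal.ofReal_le_ofReal ?_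
    have h := hpos z hz
    have hc := (hχI (φ z)).1
    have e : 1 + a = s / q := by rw [ha, hs]; field_simp; ring
    have e' : s / q * q = s := by field_simp
    rw [hθφ z hz, Real.norm_of_nonneg (by positivity), mul_left_comm,
      Real.mul_rpow hc (by positivity)]
    nth_rewrite 2 [← Real.rpow_one ‖deriv φ z‖]
    rw [← Real.rpow_add h, e, ← Real.rpow_mul h.le, e']
    gcongr ?_ * _
    exact Real.rpow_le_rpow_of_exponent_ge_of_imp hc (hχI _).2 hqp.le fun _ h0 => absurd h0 hp.ne'
  have hKA : ∫⁻ z in K, ENNReal.ofReal (‖deriv φ z‖ ^ s) ≤ A := by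
    rw [hA']
    refine (le_of_eq ?_).trans (lintegral_mono_set hKΩ)
    refine setLIntegral_congr_fun hK.measurableSet fun z hz => ?_
    rw [hχ1 _ ⟨z, hz, rfl⟩, Real.one_rpow, one_mul]
  refine (ENNReal.rpow_le_rpow hKA (by positivity)).trans ?_
  -- The estimate now reads `A^(1/q) ≤ C A^(1/p)`. Dividing by `A^(1/p)` requires `A` finite, which
  -- compact support of `θ` ensures, and nonzero.
  have hAtop : A ≠ ⊤ := fun h => by simp [h, hp] at hfin
  rcases eq_or_ne A 0 with h0 | h0
  · rw [h0, ENNReal.zero_rpow_of_pos (by positivity)]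
    exact zero_le
  · have e : (p - q) / (p * q) = 1 / q + -(1 / p) := by field_simp; ring
    calc A ^ ((p - q) / (p * q)) = A ^ (1 / q) * A ^ (-(1 / p)) := by
          rw [e, ENNReal.rpow_add _ _ h0 hAtop]
      _ ≤ C * A ^ (1 / p) * A ^ (-(1 / p)) := by
          gcongr
          exact (ENNReal.rpow_le_rpow hB (by positivity)).trans hmain
      _ = C := by
          rw [mul_assoc, ← ENNReal.rpow_add _ _ h0 hAtop, add_neg_cancel, ENNReal.rpow_zero,
            mul_one]

/-- The integral of a nonnegative function over an open set is the supremum of its integrals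
over compact subsets. -/
theorem IsOpen.setLIntegral_le_of_forall_isCompact {Ω : Set ℂ} (hΩ : IsOpen Ω) {f : ℂ → ℝ≥0∞}
    {M : ℝ≥0∞} (h : ∀ K, IsCompact K → K ⊆ Ω → ∫⁻ z in K, f z ≤ M) : ∫⁻ z in Ω, f z ≤ M := by
  obtain ⟨F, hF, hFΩ, hFU, hFm⟩ := hΩ.exists_iUnion_isClosed
  have hm : Monotone fun n : ℕ => F n ∩ Metric.closedBall 0 (n : ℝ) := fun m n hmn =>
    Set.inter_subset_inter (hFm hmn) (Metric.closedBall_subset_closedBall (by exact_mod_cast hmn))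
  have hU : ⋃ n : ℕ, F n ∩ Metric.closedBall 0 (n : ℝ) = Ω := by
    rw [Set.iUnion_inter_of_monotone hFm fun m n hmn =>
      Metric.closedBall_subset_closedBall (by exact_mod_cast hmn), hFU,
      Metric.iUnion_closedBall_nat, Set.inter_univ]
  rw [← hU, setLIntegral_iUnion_of_directed _ hm.directed_le]
  exact iSup_le fun n => h _ ((isCompact_closedBall _ _).inter_left (hF n))
    (Set.inter_subset_left.trans (hFΩ n))

theorem theorem4p4 (Ω Ω' : Set ℂ) (hΩ : IsPlaneDomain Ω) (hΩ' : IsPlaneDomain Ω')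
    (φ : ℂ → ℂ) (hφ : IsConformalHomeomorph φ Ω Ω')
    (p q : ℝ) (hq : 1 ≤ q) (hqp : q < p) :
    InducesBoundedComposition φ Ω Ω' p q ↔
      (∫⁻ z in Ω, ENNReal.ofReal (‖deriv φ z‖ ^ ((p - 2) * q / (p - q))))
        ^ ((p - q) / (p * q)) < (⊤ : ℝ≥0∞) := by
  have hq0 : 0 < q := one_pos.trans_le hq
  have hp0 : 0 < p := hq0.trans hqp
  refine ⟨fun h => ?_, hφ.inducesBoundedComposition hΩ.1 hΩ'.1 hq0 hqp⟩
  obtain ⟨K, hK⟩ := h.exists_eLpNorm_le hφ hΩ.1 hΩ'.1 hp0 hq0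
  have he : 0 < (p - q) / (p * q) := div_pos (sub_pos.2 hqp) (mul_pos hp0 hq0)
  have hle : (∫⁻ z in Ω, ENNReal.ofReal (‖deriv φ z‖ ^ ((p - 2) * q / (p - q))))
      ^ ((p - q) / (p * q)) ≤ 2 * K := by
    -- The outer power is moved to the other side so that the supremum over compact sets is taken of
    -- the integral itself; `2 * K` does not depend on the compact set.
    rw [← ENNReal.le_rpow_inv_iff he]
    refine hΩ.1.setLIntegral_le_of_forall_isCompact fun L hL hLΩ => ?_
    rw [ENNReal.le_rpow_inv_iff he]
    exact hφ.setLIntegral_compact_le hΩ.1 hΩ'.1 hq0 hqp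
      (fun θ hθ hc => eLpNorm_weighted_le_of_gradient_le hφ hΩ.1
        (ENNReal.one_le_ofReal.2 (hq.trans hqp.le)) (ENNReal.one_le_ofReal.2 hq) hK hθ hc) hL hLΩ
  exact hle.trans_lt (ENNReal.mul_lt_top (by simp) ENNReal.coe_lt_top)
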